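/- Let $X$ be a topological space in which compact sets are Borel, $(\mu_\alpha)$ a net of Borel probability measures on $X$, and $(t_\alpha)$ a net in $]0,+\infty[$ (with the same index set) converging to $0$. All limits of nets are along $\alpha$; write $\mu_\alpha^{t_\alpha}(B)=\mu_\alpha(B)^{t_\alpha}$, and for a Borel function $h:X\to[-\infty,+\infty[$ write $\mu_\alpha^{t_\alpha}(e^{h/t_\alpha})=\big(\int_X e^{h(x)/t_\alpha}\mu_\alpha(dx)\big)^{t_\alpha}$, $$\overline\Lambda(h)=\log\limsup\mu_\alpha^{t_\alpha}(e^{h/t_\alpha}),\qquad \underline\Lambda(h)=\log\liminf\mu_\alpha^{t_\alpha}(e^{h/t_\alpha}),$$ and $\Lambda(h)=\log\lim\mu_\alpha^{t_\alpha}(e^{h/t_\alpha})$ when this limit exists in $[0,+\infty]$. A function $J:X\to[0,+\infty]$ is a rate function for a large deviation principle of $(\mu_\alpha)$ with powers $(t_\alpha)$ if $J$ is lower semicontinuous, $\limsup\mu_\alpha^{t_\alpha}(F)\le\sup_{F}e^{-J}$ for all closed $F$, and $\sup_{G}e^{-J}\le\liminf\mu_\alpha^{t_\alpha}(G)$ for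 all open $G$. Let $X_0$ be the set of points $x\in X$ such that for every open $G\ni x$ and all reals $s,t>0$ there is a bounded continuous $h:X\to\mathbb R$ with $e^{-t}1_{\{x\}}\le e^h\le 1_G\vee e^{-s}$. Let $l_0(x)=-\log\inf\{\limsup\mu_\alpha^{t_\alpha}(G): G \text{ open}, G\ni x\}$. Assume that $(\mu_\alpha)$ is exponentially tight with respect to $(t_\alpha)$, i.e. for each $\varepsilon>0$ there is a compact $K\subset X$ with $\limsup\mu_\alpha^{t_\alpha}(X\setminus K)<\varepsilon$, and that at least one of the following holds: (i) ($X_0$-exponential tightness) for each $\varepsilon>0$ there is a compact $K\subset X_0$ with $\limsup\mu_\alpha^{t_\alpha}(X\setminus K)<\varepsilon$; (ii) $l_0=+\infty$ on $X\setminus X_0$; (iii) for every closed $F$, every cover $\mathcal U$ of $F\cap X_0$ by open sets and every $\varepsilon>0$, there is a finite (possibly empty) $\mathcal V\subset\mathcal U$ with $\limsup\mu_\alpha^{t_\alpha}(F)-\limsup\mu_\alpha^{t_\alpha}\big(\bigcup_{G\in\mathcal V}\overline G\big)<\varepsilon$. Let $\mathcal A$ be a set of real-valued continuous functions on $X$ which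 is either an algebra (a linear subspace closed under products, not necessarily containing the constants) separating the points of $X$, or a well-separating class (it contains the constants, is closed under finite pointwise minima, and for all $x\ne y$ in $X$ and $a,b\in\mathbb R$ contains some $h$ with $h(x)=a$, $h(y)=b$). Let $\mathcal A_{ba}$ be the set of $h\in\mathcal A$ that are bounded above and $\mathcal A_-$ the set of $h\in\mathcal A$ with $h\le0$. For $h\in\mathcal A$ and $M\in\mathbb R$ let $h_M=h$ on $\{h<M\}$ and $h_M=-\infty$ on $\{h\ge M\}$. Assume that $\Lambda(h)$ exists for all $h\in\mathcal A_{ba}$; or, when $\mathcal A$ does not vanish identically at any point of $X$ (for every $x\in X$ some $h\in\mathcal A$ has $h(x)\neq0$, which always holds in the well-separating case), assume only that $\Lambda(h)$ exists for all $h\in\mathcal A_-$. Then $\Lambda(h)$ exists for all $h\in\mathcal A_{ba}$, the limit $\lim_{M\to+\infty}\underline\Lambda(h_M)$ exists in $[-\infty,+\infty]$ for all $h\in\mathcal A$, and $(\mu_\alpha)$ satisfies a large deviation principle with powers $(t_\alpha)$ and a rate function $J$ such that $J=+\infty$ on $X\setminus\overline{X_0}$ and, for all $x\in X_0$, $$J(x)=\sup_{h\in\mathcal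 A_{ba}}\{h(x)-\Lambda(h)\}=\sup_{h\in\mathcal A}\{h(x)-\overline\Lambda(h)\}=\sup_{h\in\mathcal A}\{h(x)-\underline\Lambda(h)\}=\sup_{h\in\mathcal A}\{h(x)-\lim_{M\to+\infty}\underline\Lambda(h_M)\}.$$ If $\mathcal A$ does not vanish identically at any point of $X$, then moreover $J(x)=\sup_{h\in\mathcal A_-}\{h(x)-\Lambda(h)\}$ for all $x\in X_0$. If $X$ is regular, then $J$ is the only rate function for this large deviation principle, and $$J(x)=\sup_{G\text{ open},\,G\ni x}\ \inf_{y\in G\cap X_0}J(y)\qquad\text{for all }x\in X.$$ -/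

import Mathlib

open Filter Topology MeasureTheory Set
open scoped ENNReal BoundedContinuousFunction

namespace LargeDev

noncomputable section

variable {X : Type*} [TopologicalSpace X] [MeasurableSpace X] {ι : Type*} [Preorder ι]

/-- The net `μ_α(B)^{t_α}`. -/
def powMeas (μ : ι → Measure X) (t : ι → ℝ) (B : Set X) (α : ι) : ℝ≥0∞ :=
  (μ α B) ^ (t α)

/-- The net `μ_α^{t_α}(e^{h/t_α}) = (∫ e^{h(x)/t_α} μ_α(dx))^{t_α}` for a function `h` with values
in `[-∞, +∞[` (the exponential maps `EReal` to `[0, +∞]`, with `e^{-∞} = 0`). -/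
def powInt (μ : ι → Measure X) (t : ι → ℝ) (h : X → EReal) (α : ι) : ℝ≥0∞ :=
  (∫⁻ x, EReal.exp (h x / (t α : EReal)) ∂(μ α)) ^ (t α)

/-- `Λ̄(h) = log limsup μ_α^{t_α}(e^{h/t_α})`. -/
def upperLambda (μ : ι → Measure X) (t : ι → ℝ) (h : X → EReal) : EReal :=
  ENNReal.log (limsup (powInt μ t h) atTop)

/-- `Λ̲(h) = log liminf μ_α^{t_α}(e^{h/t_α})`. -/
def lowerLambda (μ : ι → Measure X) (t : ι → ℝ) (h : X → EReal) : EReal :=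
  ENNReal.log (liminf (powInt μ t h) atTop)

/-- `Λ(h)` exists, in `[-∞, +∞]`: the net `μ_α^{t_α}(e^{h/t_α})` converges in `[0, +∞]`. -/
def LambdaExists (μ : ι → Measure X) (t : ι → ℝ) (h : X → EReal) : Prop :=
  ∃ a : ℝ≥0∞, Tendsto (powInt μ t h) atTop (𝓝 a)

/-- `Λ(h) = log lim μ_α^{t_α}(e^{h/t_α})`; only used when the limit exists. -/
def Lambda (μ : ι → Measure X) (t : ι → ℝ) (h : X → EReal) : EReal :=
  ENNReal.log (limUnder atTop (powInt μ t h))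

/-- A real-valued continuous function seen as an extended-real-valued function. -/
def toE (h : C(X, ℝ)) : X → EReal := fun x => ((h x : ℝ) : EReal)

open Classical in
/-- `h_M`, equal to `h` on `{h < M}` and to `-∞` on `{h ≥ M}`. -/
def trunc (h : C(X, ℝ)) (M : ℝ) : X → EReal :=
  fun x => if h x < M then ((h x : ℝ) : EReal) else ⊥

/-- The bounded-above part `A_ba`. -/
def baPart (A : Set C(X, ℝ)) : Set C(X, ℝ) := {h ∈ A | BddAbove (range h)}

/-- The negative part `A_-`: the elements that are everywhere `≤ 0`. -/
def nonposPart (A : Set C(X, ℝ)) : Set C(X, ℝ) := {h ∈ A | ∀ x, h x ≤ 0}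

/-- `A` separates the points of `X`. -/
def SeparatesPts (A : Set C(X, ℝ)) : Prop :=
  ∀ x y : X, x ≠ y → ∃ h ∈ A, h x ≠ h y

/-- `A` does not vanish identically at any point of `X`. -/
def NonvanishingClass (A : Set C(X, ℝ)) : Prop :=
  ∀ x : X, ∃ h ∈ A, h x ≠ 0

/-- `A` is an algebra of continuous functions (not necessarily containing the constants) that
separates the points. -/
def IsSeparatingAlgebra (A : Set C(X, ℝ)) : Prop :=
  (∃ S : NonUnitalSubalgebra ℝ C(X, ℝ), (S : Set C(X, ℝ)) = A) ∧ SeparatesPts A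

/-- Well-separating class: contains the constants, is closed under finite pointwise minima, and
takes arbitrary prescribed values at any two distinct points. -/
structure IsWellSeparating (A : Set C(X, ℝ)) : Prop where
  const_mem : ∀ c : ℝ, ContinuousMap.const X c ∈ A
  inf_mem : ∀ f ∈ A, ∀ g ∈ A, f ⊓ g ∈ A
  separates : ∀ x y : X, x ≠ y → ∀ a b : ℝ, ∃ h ∈ A, h x = a ∧ h y = b

variable (X) in
/-- The "completely regular part" `X₀`: the points `x` such that for every open `G ∋ x` and all
reals `s, t > 0` there is `h ∈ C_b(X)` with `e^{-t} 1_{x} ≤ e^h ≤ 1_G ∨ e^{-s}`. -/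
def regPart : Set X :=
  {x | ∀ G : Set X, IsOpen G → x ∈ G → ∀ s : ℝ, 0 < s → ∀ t : ℝ, 0 < t →
    ∃ h : X →ᵇ ℝ, ∀ y : X,
      indicator {x} (fun _ => Real.exp (-t)) y ≤ Real.exp (h y) ∧
      Real.exp (h y) ≤ max (indicator G (fun _ => (1 : ℝ)) y) (Real.exp (-s))}

/-- Exponential tightness with compact sets contained in `Y`. -/
def ExpTightIn (μ : ι → Measure X) (t : ι → ℝ) (Y : Set X) : Prop :=
  ∀ ε : ℝ≥0∞, 0 < ε → ∃ K : Set X, IsCompact K ∧ K ⊆ Y ∧ limsup (powMeas μ t Kᶜ) atTop < ε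

/-- Exponential tightness of `(μ_α)` with respect to `(t_α)`. -/
def ExpTight (μ : ι → Measure X) (t : ι → ℝ) : Prop := ExpTightIn μ t univ

/-- `l₀(x) = -log inf {limsup μ_α^{t_α}(G) : G open, x ∈ G}`. -/
def lZero (μ : ι → Measure X) (t : ι → ℝ) (x : X) : EReal :=
  -ENNReal.log (⨅ (G : Set X) (_ : IsOpen G) (_ : x ∈ G), limsup (powMeas μ t G) atTop)

/-- For every closed `F` and every cover `𝒰` of `F ∩ X₀` by open sets, finitely many members of
`𝒰` have closures whose union carries `F` up to `ε` in the limit. -/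
def CoverCondition (μ : ι → Measure X) (t : ι → ℝ) : Prop :=
  ∀ F : Set X, IsClosed F → ∀ 𝒰 : Set (Set X), (∀ G ∈ 𝒰, IsOpen G) → F ∩ regPart X ⊆ ⋃₀ 𝒰 →
    ∀ ε : ℝ≥0∞, 0 < ε → ∃ 𝒱 : Set (Set X), 𝒱 ⊆ 𝒰 ∧ 𝒱.Finite ∧
      limsup (powMeas μ t F) atTop < limsup (powMeas μ t (⋃ G ∈ 𝒱, closure G)) atTop + ε

/-- Large deviation upper bounds with powers `(t_α)` and function `l`. -/
def UpperBounds (μ : ι → Measure X) (t : ι → ℝ) (l : X → ℝ≥0∞) : Prop :=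
  ∀ F : Set X, IsClosed F →
    limsup (powMeas μ t F) atTop ≤ ⨆ x ∈ F, EReal.exp (-((l x : ℝ≥0∞) : EReal))

/-- Large deviation lower bounds with powers `(t_α)` and function `l`. -/
def LowerBounds (μ : ι → Measure X) (t : ι → ℝ) (l : X → ℝ≥0∞) : Prop :=
  ∀ G : Set X, IsOpen G →
    (⨆ x ∈ G, EReal.exp (-((l x : ℝ≥0∞) : EReal))) ≤ liminf (powMeas μ t G) atTop

/-- `(μ_α)` satisfies a large deviation principle with powers `(t_α)` and rate function `J`. The
bounds are unaffected when a function is replaced by its lower regularization, so a rate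
function is a lower semicontinuous function with which both bounds hold. -/
structure IsLDP (μ : ι → Measure X) (t : ι → ℝ) (J : X → ℝ≥0∞) : Prop where
  lsc : LowerSemicontinuous J
  upper : UpperBounds μ t J
  lower : LowerBounds μ t J

end

end LargeDev

open LargeDev

/-! Since `2 ^ t α → 1`, the limsup of `μ_α^{t_α}` turns finite unions into maxima. It is therefore
controlled by the local capacity `upperCap`, by covering on compact sets and by tightness elsewhere.
Tilting carries this over to integrals: for continuous `h` bounded above, the limsup of `powInt` is
at most sup e^h `upperCap`, while its liminf is at least sup e^h `lowerCap`.

The class `A` supplies peaks (`exists_peak`): functions maximal at `x` and far below `h x` on a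
given compact set missing `x`. By tightness, for each `b > lowerCap x` some peak has liminf at most
e^{h x} b (`exists_liminf_powInt_le`), whereas its limsup is at least e^{h x} `upperCap x`. If Λ(h)
exists, the two capacities must agree (`lowerCap_eq_upperCap`). Hence Λ exists on all of `A_ba`, and
every transform in the statement is squeezed onto -log of the common capacity.

Each of the three alternative conditions bounds closed sets by the capacity on X₀ alone
(`limsup_powMeas_le_regPart`). The rate function is thus the lower regularization of -log capacity
restricted to X₀. It keeps its values on X₀ because the capacity is upper semicontinuous. -/

namespace LargeDev

/-! ### Local capacities, maxitivity and tilting -/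

section Capacities

variable {X : Type*} [TopologicalSpace X] [MeasurableSpace X] {ι : Type*} [Preorder ι]

/-- The upper local capacity `x ↦ inf {limsup μ_α^{t_α}(G) : G open, x ∈ G}`. -/
noncomputable def upperCap (μ : ι → Measure X) (t : ι → ℝ) (x : X) : ℝ≥0∞ :=
  ⨅ (G : Set X) (_ : IsOpen G) (_ : x ∈ G), limsup (powMeas μ t G) atTop

/-- The lower local capacity `x ↦ inf {liminf μ_α^{t_α}(G) : G open, x ∈ G}`. -/
noncomputable def lowerCap (μ : ι → Measure X) (t : ι → ℝ) (x : X) : ℝ≥0∞ :=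
  ⨅ (G : Set X) (_ : IsOpen G) (_ : x ∈ G), liminf (powMeas μ t G) atTop

/-- The net of measures with densities `e^{h/t_α}` with respect to `μ_α`. -/
noncomputable def tilt (μ : ι → Measure X) (t : ι → ℝ) (h : C(X, ℝ)) (α : ι) : Measure X :=
  (μ α).withDensity fun x => EReal.exp (toE h x / (t α : EReal))

omit [Preorder ι] in
-- Lets the estimates for sets, which do not need probability measures, be applied to exponential
-- integrals.
lemma powInt_eq_powMeas_tilt (μ : ι → Measure X) (t : ι → ℝ) (h : C(X, ℝ)) :
    powInt μ t (toE h) = powMeas (tilt μ t h) t univ := by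
  ext α
  simp [powInt, powMeas, tilt]

variable {μ : ι → Measure X} {t : ι → ℝ}

omit [TopologicalSpace X] [Preorder ι] in
lemma powMeas_mono (ht : ∀ α, 0 < t α) {A B : Set X} (h : A ⊆ B) (α : ι) :
    powMeas μ t A α ≤ powMeas μ t B α :=
  ENNReal.rpow_le_rpow (measure_mono h) (ht α).le

omit [TopologicalSpace X] in
lemma limsup_powMeas_mono (ht : ∀ α, 0 < t α) {A B : Set X} (h : A ⊆ B) :
    limsup (powMeas μ t A) atTop ≤ limsup (powMeas μ t B) atTop :=
  limsup_le_limsup (Eventually.of_forall (powMeas_mono ht h))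

omit [TopologicalSpace X] [Preorder ι] in
lemma powMeas_le_one [∀ α, IsProbabilityMeasure (μ α)] (ht : ∀ α, 0 < t α) (A : Set X) (α : ι) :
    powMeas μ t A α ≤ 1 :=
  ENNReal.rpow_le_one prob_le_one (ht α).le

omit [TopologicalSpace X] [Preorder ι] in
lemma powMeas_empty (ht : ∀ α, 0 < t α) : powMeas μ t ∅ = fun _ => 0 := by
  ext α
  simp [powMeas, ht α]

omit [TopologicalSpace X] [Preorder ι] in
lemma powMeas_union_le (ht : ∀ α, 0 < t α) (A B : Set X) (α : ι) :
    powMeas μ t (A ∪ B) α ≤ 2 ^ t α * max (powMeas μ t A α) (powMeas μ t B α) := by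
  have h : μ α (A ∪ B) ≤ 2 * max (μ α A) (μ α B) := by
    rw [two_mul]
    exact (measure_union_le A B).trans (add_le_add (le_max_left _ _) (le_max_right _ _))
  refine (ENNReal.rpow_le_rpow h (ht α).le).trans ?_
  rw [ENNReal.mul_rpow_of_nonneg _ _ (ht α).le,
    (ENNReal.monotone_rpow_of_nonneg (ht α).le).map_max]
  rfl

/-- The one place where the convergence of `t` to 0 enters: it makes the constant of the union bound
disappear in the limit. -/
lemma eventually_two_rpow_mul_lt (ht0 : Tendsto t atTop (𝓝 0)) {b c : ℝ≥0∞} (hbc : b < c) :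
    ∀ᶠ α in atTop, (2 : ℝ≥0∞) ^ t α * b < c := by
  have h2 : Tendsto (fun α => (2 : ℝ≥0∞) ^ t α) atTop (𝓝 1) := by
    have h1 : Tendsto (fun α => ENNReal.ofReal ((2 : ℝ) ^ t α)) atTop
        (𝓝 (ENNReal.ofReal ((2 : ℝ) ^ (0 : ℝ)))) :=
      ENNReal.tendsto_ofReal (((Real.continuous_const_rpow two_ne_zero).tendsto 0).comp ht0)
    simpa [← ENNReal.ofReal_rpow_of_pos] using h1
  have h3 : Tendsto (fun α => (2 : ℝ≥0∞) ^ t α * b) atTop (𝓝 (1 * b)) :=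
    ENNReal.Tendsto.mul_const h2 (Or.inl one_ne_zero)
  exact h3.eventually_lt_const (by simpa using hbc)

omit [TopologicalSpace X] in
lemma limsup_powMeas_union_le (ht : ∀ α, 0 < t α) (ht0 : Tendsto t atTop (𝓝 0)) (A B : Set X) :
    limsup (powMeas μ t (A ∪ B)) atTop ≤
      max (limsup (powMeas μ t A) atTop) (limsup (powMeas μ t B) atTop) := by
  refine le_of_forall_gt_imp_ge_of_dense fun c hc => ?_
  obtain ⟨b, hb, hbc⟩ := exists_between hc
  rw [max_lt_iff] at hb
  refine limsup_le_of_le (by isBoundedDefault) ?_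
  filter_upwards [eventually_lt_of_limsup_lt hb.1, eventually_lt_of_limsup_lt hb.2,
    eventually_two_rpow_mul_lt ht0 hbc] with α h1 h2 h3
  exact (powMeas_union_le ht A B α).trans
    ((mul_le_mul_right (max_le h1.le h2.le) _).trans h3.le)

omit [TopologicalSpace X] in
-- A frequent event meets an eventual one, so one piece may be controlled by its liminf only,
-- provided the other is controlled by its limsup.
lemma liminf_powMeas_union_le (ht : ∀ α, 0 < t α) (ht0 : Tendsto t atTop (𝓝 0)) (A B : Set X) :
    liminf (powMeas μ t (A ∪ B)) atTop ≤
      max (liminf (powMeas μ t A) atTop) (limsup (powMeas μ t B) atTop) := by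
  refine le_of_forall_gt_imp_ge_of_dense fun c hc => ?_
  obtain ⟨b, hb, hbc⟩ := exists_between hc
  rw [max_lt_iff] at hb
  refine liminf_le_of_frequently_le' ?_
  refine ((frequently_lt_of_liminf_lt (by isBoundedDefault) hb.1).and_eventually
    ((eventually_lt_of_limsup_lt hb.2).and (eventually_two_rpow_mul_lt ht0 hbc))).mono ?_
  rintro α ⟨h1, h2, h3⟩
  exact (powMeas_union_le ht A B α).trans
    ((mul_le_mul_right (max_le h1.le h2.le) _).trans h3.le)

omit [TopologicalSpace X] in
lemma limsup_powMeas_biUnion_le (ht : ∀ α, 0 < t α) (ht0 : Tendsto t atTop (𝓝 0))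
    {𝒱 : Set (Set X)} (hfin : 𝒱.Finite) (f : Set X → Set X) {c : ℝ≥0∞}
    (hc : ∀ G ∈ 𝒱, limsup (powMeas μ t (f G)) atTop ≤ c) :
    limsup (powMeas μ t (⋃ G ∈ 𝒱, f G)) atTop ≤ c := by
  induction 𝒱, hfin using Set.Finite.induction_on with
  | empty =>
    simp only [mem_empty_iff_false, iUnion_of_empty, iUnion_empty, powMeas_empty ht]
    exact (limsup_le_of_le (by isBoundedDefault) (Eventually.of_forall fun _ => zero_le))
  | insert _ _ ih =>
    rw [biUnion_insert]
    exact (limsup_powMeas_union_le ht ht0 _ _).trans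
      (max_le (hc _ (mem_insert _ _)) (ih fun G hG => hc G (mem_insert_of_mem _ hG)))

lemma exp_div_rpow (c : EReal) {s : ℝ} (hs : 0 < s) :
    EReal.exp (c / (s : EReal)) ^ s = EReal.exp c := by
  rw [← EReal.exp_mul, EReal.div_mul_cancel (EReal.coe_ne_bot s) (EReal.coe_ne_top s)]
  exact_mod_cast hs.ne'

omit [Preorder ι] in
lemma powMeas_tilt_le (ht : ∀ α, 0 < t α) {h : C(X, ℝ)} {G : Set X} (hG : MeasurableSet G)
    {c : ℝ} (hc : ∀ x ∈ G, h x ≤ c) (α : ι) :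
    powMeas (tilt μ t h) t G α ≤ EReal.exp c * powMeas μ t G α := by
  have hle : tilt μ t h α G ≤ EReal.exp ((c : EReal) / (t α : EReal)) * μ α G := by
    rw [tilt, withDensity_apply _ hG, ← setLIntegral_const]
    refine setLIntegral_mono measurable_const fun x hx => EReal.exp_monotone ?_
    exact EReal.div_le_div_right_of_nonneg (by exact_mod_cast (ht α).le)
      (EReal.coe_le_coe_iff.2 (hc x hx))
  refine (ENNReal.rpow_le_rpow hle (ht α).le).trans ?_
  rw [ENNReal.mul_rpow_of_nonneg _ _ (ht α).le, exp_div_rpow _ (ht α)]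
  rfl

omit [TopologicalSpace X] [Preorder ι] in
lemma exp_mul_powMeas_le_powInt (ht : ∀ α, 0 < t α) {g : X → EReal} {G : Set X}
    (hG : MeasurableSet G) {c : ℝ} (hc : ∀ x ∈ G, (c : EReal) ≤ g x) (α : ι) :
    EReal.exp c * powMeas μ t G α ≤ powInt μ t g α := by
  have hle : EReal.exp ((c : EReal) / (t α : EReal)) * μ α G ≤
      ∫⁻ x, EReal.exp (g x / (t α : EReal)) ∂(μ α) := by
    rw [← setLIntegral_const, ← lintegral_indicator hG]
    refine lintegral_mono fun x => ?_
    by_cases hx : x ∈ G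
    · rw [indicator_of_mem hx]
      exact EReal.exp_monotone (EReal.div_le_div_right_of_nonneg
        (by exact_mod_cast (ht α).le) (hc x hx))
    · simp [hx]
  refine le_trans (le_of_eq ?_) (ENNReal.rpow_le_rpow hle (ht α).le)
  rw [ENNReal.mul_rpow_of_nonneg _ _ (ht α).le, exp_div_rpow _ (ht α)]
  rfl

lemma exp_coe_ne_top (c : ℝ) : EReal.exp (c : EReal) ≠ ⊤ := by simp

lemma exp_coe_ne_zero (c : ℝ) : EReal.exp (c : EReal) ≠ 0 := by simp [Real.exp_pos]

lemma tendsto_exp_coe_mul {a : ℝ≥0∞} (r : ℝ) :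
    Tendsto (fun d : ℝ => EReal.exp (d : EReal) * a) (𝓝 r) (𝓝 (EReal.exp (r : EReal) * a)) :=
  ENNReal.Tendsto.mul_const
    ((ENNReal.continuous_exp.comp continuous_coe_real_ereal).tendsto r)
    (Or.inl (exp_coe_ne_zero r))

lemma le_exp_mul_of_forall_gt {u a : ℝ≥0∞} {r : ℝ}
    (h : ∀ d : ℝ, r < d → u ≤ EReal.exp (d : EReal) * a) : u ≤ EReal.exp (r : EReal) * a :=
  ge_of_tendsto ((tendsto_exp_coe_mul r).mono_left nhdsWithin_le_nhds)
    (by filter_upwards [self_mem_nhdsWithin (s := Ioi r)] with d hd using h d hd)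

lemma exp_mul_le_of_forall_lt {u a : ℝ≥0∞} {r : ℝ}
    (h : ∀ d : ℝ, d < r → EReal.exp (d : EReal) * a ≤ u) : EReal.exp (r : EReal) * a ≤ u :=
  le_of_tendsto ((tendsto_exp_coe_mul r).mono_left nhdsWithin_le_nhds)
    (by filter_upwards [self_mem_nhdsWithin (s := Iio r)] with d hd using h d hd)

lemma upperCap_le {G : Set X} (hG : IsOpen G) {x : X} (hx : x ∈ G) :
    upperCap μ t x ≤ limsup (powMeas μ t G) atTop :=
  iInf_le_of_le G (iInf_le_of_le hG (iInf_le _ hx))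

lemma lowerCap_le {G : Set X} (hG : IsOpen G) {x : X} (hx : x ∈ G) :
    lowerCap μ t x ≤ liminf (powMeas μ t G) atTop :=
  iInf_le_of_le G (iInf_le_of_le hG (iInf_le _ hx))

lemma exists_limsup_lt_of_upperCap_lt {x : X} {c : ℝ≥0∞} (h : upperCap μ t x < c) :
    ∃ G, IsOpen G ∧ x ∈ G ∧ limsup (powMeas μ t G) atTop < c := by
  simpa only [upperCap, iInf_lt_iff, exists_prop] using h

lemma exists_liminf_lt_of_lowerCap_lt {x : X} {c : ℝ≥0∞} (h : lowerCap μ t x < c) :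
    ∃ G, IsOpen G ∧ x ∈ G ∧ liminf (powMeas μ t G) atTop < c := by
  simpa only [lowerCap, iInf_lt_iff, exists_prop] using h

lemma upperCap_le_one [(atTop : Filter ι).NeBot] [∀ α, IsProbabilityMeasure (μ α)]
    (ht : ∀ α, 0 < t α) (x : X) : upperCap μ t x ≤ 1 :=
  (upperCap_le isOpen_univ (mem_univ x)).trans
    (limsup_le_of_le (by isBoundedDefault) (Eventually.of_forall (powMeas_le_one ht univ)))

/-- Each point of `K` has a neighbourhood with limsup below `c`; finitely many cover `K`, and a
finite union costs only a maximum. -/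
lemma limsup_powMeas_le_of_isCompact (ht : ∀ α, 0 < t α) (ht0 : Tendsto t atTop (𝓝 0))
    {K : Set X} (hK : IsCompact K) :
    limsup (powMeas μ t K) atTop ≤ ⨆ x ∈ K, upperCap μ t x := by
  refine le_of_forall_gt_imp_ge_of_dense fun c hc => ?_
  refine hK.induction_on (p := fun s => limsup (powMeas μ t s) atTop ≤ c) ?_
    (fun s s' hs h => (limsup_powMeas_mono ht hs).trans h)
    (fun s s' h h' => (limsup_powMeas_union_le ht ht0 s s').trans (max_le h h')) ?_
  · rw [powMeas_empty ht]
    exact limsup_le_of_le (by isBoundedDefault) (Eventually.of_forall fun _ => zero_le)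
  · intro x hx
    obtain ⟨G, hG, hxG, hlt⟩ :=
      exists_limsup_lt_of_upperCap_lt ((le_iSup₂ (f := fun x _ => upperCap μ t x) x hx).trans_lt hc)
    exact ⟨G, mem_nhdsWithin_of_mem_nhds (hG.mem_nhds hxG), hlt.le⟩

variable [BorelSpace X]

/-- By continuity `h < d` near `x` for each `d > h x`, and there the density is at most e^{d/t}. -/
lemma upperCap_tilt_le (ht : ∀ α, 0 < t α) (h : C(X, ℝ)) (x : X) :
    upperCap (tilt μ t h) t x ≤ EReal.exp (h x : EReal) * upperCap μ t x := by
  refine le_exp_mul_of_forall_gt fun d hd => ?_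
  -- The factor e^d is moved to the left so that the infimum on the right can be treated one `G` at
  -- a time.
  rw [mul_comm, ← ENNReal.div_le_iff_le_mul (Or.inl (exp_coe_ne_zero d))
    (Or.inl (exp_coe_ne_top d))]
  refine le_iInf fun G => le_iInf fun hG => le_iInf fun hx => ?_
  rw [ENNReal.div_le_iff_le_mul (Or.inl (exp_coe_ne_zero d))
    (Or.inl (exp_coe_ne_top d)), mul_comm, ← ENNReal.limsup_const_mul_of_ne_top (exp_coe_ne_top d)]
  have hG' : IsOpen (G ∩ {y | h y < d}) := hG.inter (isOpen_lt h.continuous continuous_const)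
  refine (upperCap_le hG' ⟨hx, hd⟩).trans (limsup_le_limsup (Eventually.of_forall fun α => ?_))
  refine (powMeas_tilt_le ht hG'.measurableSet (c := d) (fun y hy => le_of_lt hy.2) α).trans ?_
  exact mul_le_mul_right (powMeas_mono ht inter_subset_left α) _

/-- Upper half of Varadhan's formula: the compact bound for the tilted net, plus tightness for the
tail. -/
lemma limsup_powInt_le [T2Space X] (ht : ∀ α, 0 < t α) (ht0 : Tendsto t atTop (𝓝 0))
    (htight : ExpTight μ t) (h : C(X, ℝ)) (hb : BddAbove (range h)) :
    limsup (powInt μ t (toE h)) atTop ≤ ⨆ x, EReal.exp (h x : EReal) * upperCap μ t x := by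
  obtain ⟨M, hM⟩ := hb
  refine le_of_forall_gt_imp_ge_of_dense fun c hc => ?_
  -- The bound `h ≤ M` inflates the tail by at most e^M, so this choice leaves it below `c`.
  obtain ⟨K, hK, -, hKε⟩ := htight (c / EReal.exp (M : EReal))
    (ENNReal.div_pos (pos_of_gt hc).ne' (exp_coe_ne_top M))
  rw [powInt_eq_powMeas_tilt, ← union_compl_self K]
  refine (limsup_powMeas_union_le ht ht0 _ _).trans (max_le ?_ ?_)
  · refine (limsup_powMeas_le_of_isCompact ht ht0 hK).trans (le_trans ?_ hc.le)
    exact iSup₂_le fun x _ => (upperCap_tilt_le ht h x).trans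
      (le_iSup (fun x => EReal.exp (h x : EReal) * upperCap μ t x) x)
  · have h1 : limsup (powMeas (tilt μ t h) t Kᶜ) atTop ≤
        EReal.exp (M : EReal) * limsup (powMeas μ t Kᶜ) atTop := by
      rw [← ENNReal.limsup_const_mul_of_ne_top (exp_coe_ne_top M)]
      exact limsup_le_limsup (Eventually.of_forall (powMeas_tilt_le ht
        hK.isClosed.measurableSet.compl fun x _ => hM (mem_range_self x)))
    refine h1.trans ((mul_le_mul_right hKε.le _).trans ?_)
    exact ENNReal.mul_div_le

/-- Lower half of Varadhan's formula. Only a lower bound on `g` near `x` is required, so that the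
discontinuous `trunc h M` is covered too. -/
lemma exp_mul_lowerCap_le [(atTop : Filter ι).NeBot] (ht : ∀ α, 0 < t α) {g : X → EReal} {x : X}
    {r : ℝ} (hg : ∀ d : ℝ, d < r → ∀ᶠ y in 𝓝 x, (d : EReal) ≤ g y) :
    EReal.exp (r : EReal) * lowerCap μ t x ≤ liminf (powInt μ t g) atTop := by
  refine exp_mul_le_of_forall_lt fun d hd => ?_
  obtain ⟨G, hGd, hG, hxG⟩ := eventually_nhds_iff.1 (hg d hd)
  refine (mul_le_mul_right (lowerCap_le hG hxG) _).trans ?_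
  rw [← ENNReal.liminf_const_mul_of_ne_top (exp_coe_ne_top d)]
  exact liminf_le_liminf
    (Eventually.of_forall (exp_mul_powMeas_le_powInt ht hG.measurableSet hGd))

lemma exp_mul_upperCap_le [(atTop : Filter ι).NeBot] (ht : ∀ α, 0 < t α) {g : X → EReal} {x : X}
    {r : ℝ} (hg : ∀ d : ℝ, d < r → ∀ᶠ y in 𝓝 x, (d : EReal) ≤ g y) :
    EReal.exp (r : EReal) * upperCap μ t x ≤ limsup (powInt μ t g) atTop := by
  refine exp_mul_le_of_forall_lt fun d hd => ?_
  obtain ⟨G, hGd, hG, hxG⟩ := eventually_nhds_iff.1 (hg d hd)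
  refine (mul_le_mul_right (upperCap_le hG hxG) _).trans ?_
  rw [← ENNReal.limsup_const_mul_of_ne_top (exp_coe_ne_top d)]
  exact limsup_le_limsup
    (Eventually.of_forall (exp_mul_powMeas_le_powInt ht hG.measurableSet hGd))

end Capacities

/-! ### Peak functions, and closed neighbourhoods in X₀ -/

section Peaks

variable {X : Type*} [TopologicalSpace X]

lemma t2Space_of_separates {A : Set C(X, ℝ)} (hA : SeparatesPts A) : T2Space X := by
  refine T2Space.of_injective_continuous (f := fun (x : X) (h : C(X, ℝ)) => h x) ?_
    (continuous_pi fun h => h.continuous)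
  intro x y hxy
  by_contra hne
  obtain ⟨h, -, hh⟩ := hA x y hne
  exact hh (congrFun hxy h)

lemma separatesPts_of {A : Set C(X, ℝ)} (hA : IsSeparatingAlgebra A ∨ IsWellSeparating A) :
    SeparatesPts A := by
  rcases hA with hA | hA
  · exact hA.2
  · intro x y hxy
    obtain ⟨h, hh, h0, h1⟩ := hA.separates x y hxy 0 1
    exact ⟨h, hh, by simp [h0, h1]⟩

/-- A function of a well-separating class attaining its maximum `0` at `x` and small on `L`. -/
lemma IsWellSeparating.exists_peak {A : Set C(X, ℝ)} (hA : IsWellSeparating A) {x : X} {L : Set X}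
    (hL : IsCompact L) (hx : x ∉ L) (s : ℝ) :
    ∃ h ∈ A, h x = 0 ∧ (∀ y, h y ≤ 0) ∧ ∀ y ∈ L, h y ≤ -s := by
  refine hL.induction_on
    (p := fun L => ∃ h ∈ A, h x = 0 ∧ (∀ y, h y ≤ 0) ∧ ∀ y ∈ L, h y ≤ -s)
    ⟨_, hA.const_mem 0, by simp, by simp, by simp⟩ ?_ ?_ ?_
  · rintro L L' hLL ⟨h, hh, h0, h1, h2⟩
    exact ⟨h, hh, h0, h1, fun y hy => h2 y (hLL hy)⟩
  · rintro L L' ⟨h, hh, h0, h1, h2⟩ ⟨g, hg, g0, g1, g2⟩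
    refine ⟨h ⊓ g, hA.inf_mem h hh g hg, by simp [h0, g0], fun y => ?_, fun y hy => ?_⟩
    · exact (min_le_left _ _).trans (h1 y)
    · rcases hy with hy | hy
      · exact (min_le_left _ _).trans (h2 y hy)
      · exact (min_le_right _ _).trans (g2 y hy)
  · intro y hy
    have hxy : x ≠ y := fun h => hx (h ▸ hy)
    -- The extra 1 makes `g < -s` strict at `y`, hence true on a neighbourhood.
    obtain ⟨g, hg, gx, gy⟩ := hA.separates x y hxy 0 (-s - 1)
    refine ⟨{z | g z < -s}, mem_nhdsWithin_of_mem_nhds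
      ((isOpen_lt g.continuous continuous_const).mem_nhds (by simp [gy])), g ⊓ .const X 0,
      hA.inf_mem g hg _ (hA.const_mem 0), by simp [gx], fun z => min_le_right _ _,
      fun z hz => (min_le_left _ _).trans (le_of_lt hz)⟩

/-- Without constants, use v(v - v(y)), which vanishes at `y`. It fails at `x` only if v(x) = 0, and
then u(v(y) - v) works. -/
lemma exists_algebra_bump {S : NonUnitalSubalgebra ℝ C(X, ℝ)}
    (hS : SeparatesPts (S : Set C(X, ℝ))) {x y : X} (hxy : x ≠ y)
    (hx : ∃ h ∈ S, h x ≠ 0) : ∃ g ∈ S, g x = 1 ∧ g y = 0 := by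
  obtain ⟨u, hu, hux⟩ := hx
  obtain ⟨v, hv, hvxy⟩ := hS x y hxy
  suffices ∃ g ∈ S, g x ≠ 0 ∧ g y = 0 by
    obtain ⟨g, hg, gx, gy⟩ := this
    exact ⟨(g x)⁻¹ • g, S.smul_mem _ hg, by simp [gx], by simp [gy]⟩
  by_cases h1 : v x * (v x - v y) = 0
  · have hvx : v x = 0 := (mul_eq_zero.1 h1).resolve_right (sub_ne_zero.2 hvxy)
    have hvy : v y ≠ 0 := fun h => hvxy (by rw [hvx, h])
    refine ⟨v y • u - u * v, S.sub_mem (S.smul_mem _ hu) (S.mul_mem hu hv), ?_, ?_⟩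
    · simp [hvx, hvy, hux]
    · simp [mul_comm]
  · exact ⟨v * v - v y • v, S.sub_mem (S.mul_mem hv hv) (S.smul_mem _ hv),
      fun h => h1 ((mul_sub _ _ _).trans ((congrArg _ (mul_comm _ _)).trans h)), by simp⟩

/-- A function of a separating algebra attaining its maximum at `x`, and strictly smaller
at `y`; the maximum can be taken to be `0` when the algebra vanishes nowhere. -/
lemma exists_algebra_two_point_peak {S : NonUnitalSubalgebra ℝ C(X, ℝ)}
    (hS : SeparatesPts (S : Set C(X, ℝ))) {x y : X} (hxy : x ≠ y) :
    ∃ h ∈ S, (∀ z, h z ≤ h x) ∧ h y < h x ∧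
      (NonvanishingClass (S : Set C(X, ℝ)) → h x = 0) := by
  by_cases hy : ∃ h ∈ S, h y ≠ 0
  · obtain ⟨g, hg, gy, gx⟩ := exists_algebra_bump hS hxy.symm hy
    exact ⟨-(g * g), S.neg_mem (S.mul_mem hg hg), fun z => by simpa [gx] using mul_self_nonneg (g z),
      by simp [gx, gy], fun _ => by simp [gx]⟩
  · have hx : ∃ h ∈ S, h x ≠ 0 := by
      obtain ⟨v, hv, hvxy⟩ := hS x y hxy
      refine ⟨v, hv, fun h => hvxy ?_⟩
      rw [h, not_not.1 fun h' => hy ⟨v, hv, h'⟩]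
    obtain ⟨g, hg, gx, gy⟩ := exists_algebra_bump hS hxy hx
    -- All of `S` vanishes at `y`, so the peak is 2g - g² = 1 - (g - 1)², with maximum 1 at `x`.
    refine ⟨(2 : ℝ) • g - g * g, S.sub_mem (S.smul_mem _ hg) (S.mul_mem hg hg), fun z => ?_, ?_,
      fun hn => absurd (hn y) hy⟩
    · simp only [ContinuousMap.sub_apply, ContinuousMap.smul_apply, ContinuousMap.mul_apply,
        smul_eq_mul, gx]
      nlinarith [sq_nonneg (g z - 1)]
    · simp only [ContinuousMap.sub_apply, ContinuousMap.smul_apply, ContinuousMap.mul_apply,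
        smul_eq_mul, gx, gy]
      norm_num

/-- Sums replace minima: functions maximal at the same `x` add without losing their gaps, and
positive scaling widens a gap to `s`. -/
lemma IsSeparatingAlgebra.exists_peak {A : Set C(X, ℝ)} (hA : IsSeparatingAlgebra A) {x : X}
    {L : Set X} (hL : IsCompact L) (hx : x ∉ L) {s : ℝ} (hs : 0 < s) :
    ∃ h ∈ A, (∀ y, h y ≤ h x) ∧ (∀ y ∈ L, h y ≤ h x - s) ∧ (NonvanishingClass A → h x = 0) := by
  obtain ⟨⟨S, rfl⟩, hS⟩ := hA
  refine hL.induction_on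
    (p := fun L => ∃ h ∈ (S : Set C(X, ℝ)), (∀ y, h y ≤ h x) ∧ (∀ y ∈ L, h y ≤ h x - s) ∧
      (NonvanishingClass (S : Set C(X, ℝ)) → h x = 0))
    ⟨0, S.zero_mem, by simp, by simp, by simp⟩ ?_ ?_ ?_
  · rintro L L' hLL ⟨h, hh, h1, h2, h3⟩
    exact ⟨h, hh, h1, fun y hy => h2 y (hLL hy), h3⟩
  · rintro L L' ⟨h, hh, h1, h2, h3⟩ ⟨g, hg, g1, g2, g3⟩
    refine ⟨h + g, S.add_mem hh hg, fun y => add_le_add (h1 y) (g1 y), fun y hy => ?_,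
      fun hn => by simp [h3 hn, g3 hn]⟩
    simp only [ContinuousMap.add_apply]
    rcases hy with hy | hy
    · linarith [h2 y hy, g1 y]
    · linarith [h1 y, g2 y hy]
  · intro y hy
    have hxy : x ≠ y := fun h => hx (h ▸ hy)
    obtain ⟨g, hg, g1, g2, g3⟩ := exists_algebra_two_point_peak hS hxy
    obtain ⟨d, hd, hd'⟩ := exists_between g2
    have hpos : 0 < g x - d := sub_pos.2 hd'
    refine ⟨{z | g z < d}, mem_nhdsWithin_of_mem_nhds
      ((isOpen_lt g.continuous continuous_const).mem_nhds hd), (s / (g x - d)) • g,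
      S.smul_mem _ hg, fun z => ?_, fun z hz => ?_, fun hn => by simp [g3 hn]⟩
    · exact mul_le_mul_of_nonneg_left (g1 z) (by positivity)
    · have h1 : s / (g x - d) * g z ≤ s / (g x - d) * d :=
        mul_le_mul_of_nonneg_left (le_of_lt hz) (by positivity)
      have h2 : s / (g x - d) * (g x - d) = s := div_mul_cancel₀ _ hpos.ne'
      simp only [ContinuousMap.smul_apply, smul_eq_mul]
      linarith [mul_sub (s / (g x - d)) (g x) d]

lemma exists_peak {A : Set C(X, ℝ)} (hA : IsSeparatingAlgebra A ∨ IsWellSeparating A) {x : X}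
    {L : Set X} (hL : IsCompact L) (hx : x ∉ L) {s : ℝ} (hs : 0 < s) :
    ∃ h ∈ A, (∀ y, h y ≤ h x) ∧ (∀ y ∈ L, h y ≤ h x - s) ∧ (NonvanishingClass A → h x = 0) := by
  rcases hA with hA | hA
  · exact hA.exists_peak hL hx hs
  · obtain ⟨h, hh, h0, h1, h2⟩ := hA.exists_peak hL hx s
    exact ⟨h, hh, by simpa [h0] using h1, by simpa [h0] using h2, fun _ => h0⟩

/-- A point of the completely regular part has arbitrarily small closed neighbourhoods. -/
lemma exists_closure_subset_of_mem_regPart {x : X} (hx : x ∈ regPart X) {G : Set X}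
    (hG : IsOpen G) (hxG : x ∈ G) : ∃ V, IsOpen V ∧ x ∈ V ∧ closure V ⊆ G := by
  -- `h ≥ -1` at `x` and `h ≤ -2` off `G`; the level -3/2 lies strictly between.
  obtain ⟨h, hh⟩ := hx G hG hxG 2 two_pos 1 one_pos
  have hx1 : -1 ≤ h x := by simpa using (hh x).1
  refine ⟨{y | (-3 / 2 : ℝ) < h y}, isOpen_lt continuous_const h.continuous,
    show (-3 / 2 : ℝ) < h x by linarith, ?_⟩
  refine (closure_lt_subset_le continuous_const h.continuous).trans fun y hy => ?_
  by_contra hyG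
  have h2 := (hh y).2
  rw [indicator_of_notMem hyG, max_eq_right (Real.exp_pos _).le, Real.exp_le_exp] at h2
  have h3 : (-3 / 2 : ℝ) ≤ h y := hy
  linarith

end Peaks

/-! ### Closed sets and X₀; equality of the two capacities -/

section Capacities

variable {X : Type*} [TopologicalSpace X] [MeasurableSpace X]
  {ι : Type*} [Preorder ι] {μ : ι → Measure X} {t : ι → ℝ}

lemma limsup_powMeas_le_of_expTightIn (ht : ∀ α, 0 < t α) (ht0 : Tendsto t atTop (𝓝 0))
    {Y : Set X} (hY : ExpTightIn μ t Y) {F : Set X} (hF : IsClosed F) :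
    limsup (powMeas μ t F) atTop ≤ ⨆ x ∈ F ∩ Y, upperCap μ t x := by
  refine le_of_forall_gt_imp_ge_of_dense fun c hc => ?_
  obtain ⟨K, hK, hKY, hKc⟩ := hY c (pos_of_gt hc)
  have hsub : F ⊆ F ∩ K ∪ Kᶜ := fun x hx =>
    (em (x ∈ K)).imp (fun h => ⟨hx, h⟩) id
  refine ((limsup_powMeas_mono ht hsub).trans (limsup_powMeas_union_le ht ht0 _ _)).trans
    (max_le (le_trans ?_ hc.le) hKc.le)
  refine (limsup_powMeas_le_of_isCompact ht ht0 (hK.inter_left hF)).trans ?_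
  exact biSup_mono fun x hx => ⟨hx.1, hKY hx.2⟩

/-- Points of X₀ have small closed neighbourhoods, so F ∩ X₀ is covered by open sets whose closures
already have limsup at most `c`. -/
lemma limsup_powMeas_le_of_coverCondition (ht : ∀ α, 0 < t α) (ht0 : Tendsto t atTop (𝓝 0))
    (hcov : CoverCondition μ t) {F : Set X} (hF : IsClosed F) :
    limsup (powMeas μ t F) atTop ≤ ⨆ x ∈ F ∩ regPart X, upperCap μ t x := by
  refine le_of_forall_gt_imp_ge_of_dense fun c hc => ?_
  refine ENNReal.le_of_forall_pos_le_add fun ε hε _ => ?_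
  obtain ⟨𝒱, h𝒱, hfin, hlt⟩ := hcov F hF
    {V | IsOpen V ∧ limsup (powMeas μ t (closure V)) atTop ≤ c} (fun V hV => hV.1) (fun x hx => by
      obtain ⟨G, hG, hxG, hGc⟩ := exists_limsup_lt_of_upperCap_lt
        ((le_iSup₂ (f := fun x _ => upperCap μ t x) x hx).trans_lt hc)
      obtain ⟨V, hV, hxV, hVG⟩ := exists_closure_subset_of_mem_regPart hx.2 hG hxG
      exact ⟨V, ⟨hV, (limsup_powMeas_mono ht hVG).trans hGc.le⟩, hxV⟩)
    ε (by exact_mod_cast hε)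
  exact hlt.le.trans (add_le_add_left
    (limsup_powMeas_biUnion_le ht ht0 hfin closure fun G hG => (h𝒱 hG).2) _)

lemma upperCap_eq_zero_of_lZero {x : X} (hx : lZero μ t x = ⊤) : upperCap μ t x = 0 := by
  simpa [lZero, upperCap] using hx

lemma limsup_powMeas_le_regPart (ht : ∀ α, 0 < t α) (ht0 : Tendsto t atTop (𝓝 0))
    (htight : ExpTight μ t)
    (hcond : ExpTightIn μ t (regPart X) ∨ (∀ x ∉ regPart X, lZero μ t x = ⊤) ∨
      CoverCondition μ t) {F : Set X} (hF : IsClosed F) :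
    limsup (powMeas μ t F) atTop ≤ ⨆ x ∈ F ∩ regPart X, upperCap μ t x := by
  rcases hcond with h | h | h
  · exact limsup_powMeas_le_of_expTightIn ht ht0 h hF
  · refine (limsup_powMeas_le_of_expTightIn ht ht0 htight hF).trans (iSup₂_le fun x hx => ?_)
    by_cases hx0 : x ∈ regPart X
    · exact le_iSup₂ (f := fun x _ => upperCap μ t x) x ⟨hx.1, hx0⟩
    · simp [upperCap_eq_zero_of_lZero (h x hx0)]
  · exact limsup_powMeas_le_of_coverCondition ht ht0 h hF

lemma exists_exp_neg_le {b : ℝ≥0∞} (hb : 0 < b) :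
    ∃ s : ℝ, 0 < s ∧ EReal.exp ((-s : ℝ) : EReal) ≤ b := by
  obtain ⟨r, -, hr⟩ := EReal.lt_iff_exists_real_btwn.1 (ENNReal.bot_lt_log_iff.2 hb)
  refine ⟨max 1 (-r), by positivity, ?_⟩
  rw [← ENNReal.exp_log b]
  refine EReal.exp_monotone (le_trans ?_ hr.le)
  exact_mod_cast neg_le.1 (le_max_right 1 (-r))

variable [BorelSpace X] [(atTop : Filter ι).NeBot]

/-- Split the space into a neighbourhood `G` with liminf below `b`, the rest of a compact `K`, and a
tail below `b`. A peak of depth `s` with e^{-s} ≤ b makes each piece contribute at most e^{h x} b.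
-/
lemma exists_liminf_powInt_le [T2Space X] [∀ α, IsProbabilityMeasure (μ α)] (ht : ∀ α, 0 < t α)
    (ht0 : Tendsto t atTop (𝓝 0)) (htight : ExpTight μ t) {A : Set C(X, ℝ)}
    (hA : IsSeparatingAlgebra A ∨ IsWellSeparating A) {x : X} {b : ℝ≥0∞}
    (hb : lowerCap μ t x < b) :
    ∃ h ∈ A, BddAbove (range h) ∧ (NonvanishingClass A → ∀ y, h y ≤ 0) ∧
      liminf (powInt μ t (toE h)) atTop ≤ EReal.exp (h x : EReal) * b := by
  obtain ⟨G, hG, hxG, hGb⟩ := exists_liminf_lt_of_lowerCap_lt hb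
  obtain ⟨K, hK, -, hKb⟩ := htight b (pos_of_gt hb)
  obtain ⟨s, hs, hsb⟩ := exists_exp_neg_le (pos_of_gt hb)
  obtain ⟨h, hh, hmax, hL, h0⟩ := exists_peak hA (hK.diff hG) (fun hx => hx.2 hxG) hs
  refine ⟨h, hh, ⟨h x, forall_mem_range.2 hmax⟩, fun hn y => h0 hn ▸ hmax y, ?_⟩
  have huniv : (univ : Set X) = G ∪ (K \ G ∪ Kᶜ) := by
    ext y
    by_cases hy : y ∈ G <;> by_cases hyK : y ∈ K <;> simp [hy, hyK]
  have hle : ∀ {B : Set X}, MeasurableSet B → ∀ α,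
      powMeas (tilt μ t h) t B α ≤ EReal.exp (h x : EReal) * powMeas μ t B α := fun hB α =>
    powMeas_tilt_le ht hB (fun y _ => hmax y) α
  rw [powInt_eq_powMeas_tilt, huniv]
  refine (liminf_powMeas_union_le ht ht0 _ _).trans (max_le ?_
    ((limsup_powMeas_union_le ht ht0 _ _).trans (max_le ?_ ?_)))
  · refine (liminf_le_liminf (Eventually.of_forall (hle hG.measurableSet))).trans ?_
    rw [ENNReal.liminf_const_mul_of_ne_top (exp_coe_ne_top _)]
    exact mul_le_mul_right hGb.le _
  · refine limsup_le_of_le (by isBoundedDefault) (Eventually.of_forall fun α => ?_)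
    refine (powMeas_tilt_le ht (hK.isClosed.measurableSet.diff hG.measurableSet) hL α).trans ?_
    refine (mul_le_mul_right (powMeas_le_one ht _ α) _).trans ?_
    rw [mul_one, sub_eq_add_neg, EReal.coe_add, EReal.exp_add]
    exact mul_le_mul_right hsb _
  · refine (limsup_le_limsup (Eventually.of_forall (hle hK.isClosed.measurableSet.compl))).trans ?_
    rw [ENNReal.limsup_const_mul_of_ne_top (exp_coe_ne_top _)]
    exact mul_le_mul_right hKb.le _

omit [MeasurableSpace X] [BorelSpace X] in
lemma eventually_coe_le_toE (h : C(X, ℝ)) (x : X) (d : ℝ) (hd : d < h x) :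
    ∀ᶠ y in 𝓝 x, (d : EReal) ≤ toE h y := by
  filter_upwards [h.continuous.continuousAt.eventually_const_lt hd] with y hy
  exact EReal.coe_le_coe_iff.2 hy.le

omit [MeasurableSpace X] [BorelSpace X] in
lemma eventually_coe_le_trunc (h : C(X, ℝ)) (x : X) {M : ℝ} (hM : h x < M) (d : ℝ)
    (hd : d < h x) : ∀ᶠ y in 𝓝 x, (d : EReal) ≤ trunc h M y := by
  filter_upwards [h.continuous.continuousAt.eventually_const_lt hd,
    h.continuous.continuousAt.eventually_lt_const hM] with y hy hyM
  rw [trunc, if_pos hyM]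
  exact EReal.coe_le_coe_iff.2 hy.le

lemma lowerCap_eq_upperCap [T2Space X] [∀ α, IsProbabilityMeasure (μ α)] (ht : ∀ α, 0 < t α)
    (ht0 : Tendsto t atTop (𝓝 0)) (htight : ExpTight μ t) {A : Set C(X, ℝ)}
    (hA : IsSeparatingAlgebra A ∨ IsWellSeparating A)
    (hΛ : (∀ h ∈ baPart A, LambdaExists μ t (toE h)) ∨
      (NonvanishingClass A ∧ ∀ h ∈ nonposPart A, LambdaExists μ t (toE h))) (x : X) :
    lowerCap μ t x = upperCap μ t x := by
  refine le_antisymm (iInf_mono fun G => iInf₂_mono fun _ _ => liminf_le_limsup) ?_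
  refine le_of_forall_gt_imp_ge_of_dense fun b hb => ?_
  obtain ⟨h, hh, hbdd, hnv, hle⟩ := exists_liminf_powInt_le ht ht0 htight hA hb
  obtain ⟨a, ha⟩ : LambdaExists μ t (toE h) := by
    rcases hΛ with hΛ | ⟨hn, hΛ⟩
    · exact hΛ h ⟨hh, hbdd⟩
    · exact hΛ h ⟨hh, hnv hn⟩
  rw [ha.liminf_eq] at hle
  have h1 := exp_mul_upperCap_le (μ := μ) ht (eventually_coe_le_toE h x)
  rw [ha.limsup_eq] at h1
  exact (ENNReal.mul_le_mul_iff_right (exp_coe_ne_zero _) (exp_coe_ne_top _)).1 (h1.trans hle)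

/-- Once the capacities agree, the two halves of Varadhan's formula meet. -/
lemma lambdaExists_of_bddAbove [T2Space X] (ht : ∀ α, 0 < t α) (ht0 : Tendsto t atTop (𝓝 0))
    (htight : ExpTight μ t) (hcap : ∀ x, lowerCap μ t x = upperCap μ t x) (h : C(X, ℝ))
    (hb : BddAbove (range h)) : LambdaExists μ t (toE h) := by
  refine ⟨_, tendsto_of_le_liminf_of_limsup_le (a := ⨆ x, EReal.exp (h x : EReal) * upperCap μ t x)
    (iSup_le fun x => ?_) (limsup_powInt_le ht ht0 htight h hb)⟩
  rw [← hcap]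
  exact exp_mul_lowerCap_le ht (eventually_coe_le_toE h x)

end Capacities

/-! ### Logarithms of extended nonnegative reals -/

section Logarithms

lemma coe_sub_coe_add_self (r : ℝ) (b : EReal) : (r : EReal) - (r + b) = -b := by
  induction b with
  | bot => simp
  | top => simp
  | coe b => norm_cast; ring

lemma neg_log_le_sub_log {a b : ℝ≥0∞} {r : ℝ} (h : a ≤ EReal.exp (r : EReal) * b) :
    -ENNReal.log b ≤ (r : EReal) - ENNReal.log a := by
  rw [← coe_sub_coe_add_self r]
  refine EReal.sub_le_sub le_rfl ?_
  simpa only [ENNReal.log_mul_add, EReal.log_exp] using ENNReal.log_monotone h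

lemma sub_log_le_neg_log {a b : ℝ≥0∞} {r : ℝ} (h : EReal.exp (r : EReal) * b ≤ a) :
    (r : EReal) - ENNReal.log a ≤ -ENNReal.log b := by
  rw [← coe_sub_coe_add_self r]
  refine EReal.sub_le_sub le_rfl ?_
  simpa only [ENNReal.log_mul_add, EReal.log_exp] using ENNReal.log_monotone h

/-- The map `a ↦ (-log a)⁺`. -/
noncomputable def negLog (a : ℝ≥0∞) : ℝ≥0∞ := (-ENNReal.log a).toENNReal

lemma negLog_antitone : Antitone negLog := fun _ _ h =>
  EReal.toENNReal_le_toENNReal (EReal.neg_le_neg_iff.2 (ENNReal.log_monotone h))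

lemma coe_negLog {a : ℝ≥0∞} (ha : a ≤ 1) : ((negLog a : ℝ≥0∞) : EReal) = -ENNReal.log a :=
  EReal.coe_toENNReal (by simpa [EReal.le_neg] using ha)

lemma exp_neg_coe_negLog {a : ℝ≥0∞} (ha : a ≤ 1) :
    EReal.exp (-((negLog a : ℝ≥0∞) : EReal)) = a := by
  rw [coe_negLog ha, neg_neg, ENNReal.exp_log]

lemma exp_neg_coe_le_iff {b c : ℝ≥0∞} :
    EReal.exp (-(b : EReal)) ≤ EReal.exp (-(c : EReal)) ↔ c ≤ b := by
  rw [EReal.exp_le_exp_iff, EReal.neg_le_neg_iff, EReal.coe_ennreal_le_coe_ennreal_iff]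

lemma exp_neg_coe_le_iff_negLog_le {a b : ℝ≥0∞} (ha : a ≤ 1) :
    EReal.exp (-(b : EReal)) ≤ a ↔ negLog a ≤ b := by
  rw [← exp_neg_coe_le_iff (b := b) (c := negLog a), exp_neg_coe_negLog ha]

end Logarithms

/-! ### Lower regularization, large deviation principle, uniqueness -/

section RateFunction

variable {X : Type*} [TopologicalSpace X]

/-- The lower regularization of the function equal to `l` on `Y` and to `+∞` off `Y`. -/
noncomputable def lowerReg (Y : Set X) (l : X → ℝ≥0∞) (x : X) : ℝ≥0∞ :=
  ⨆ (G : Set X) (_ : IsOpen G) (_ : x ∈ G), ⨅ y ∈ G ∩ Y, l y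

variable {Y : Set X} {l : X → ℝ≥0∞}

lemma le_lowerReg {G : Set X} (hG : IsOpen G) {x : X} (hx : x ∈ G) :
    ⨅ y ∈ G ∩ Y, l y ≤ lowerReg Y l x :=
  le_iSup₂_of_le G hG (le_iSup_of_le hx le_rfl)

lemma lowerReg_le {x : X} (hx : x ∈ Y) : lowerReg Y l x ≤ l x :=
  iSup_le fun _ => iSup₂_le fun _ hxG => iInf₂_le x ⟨hxG, hx⟩

lemma lowerSemicontinuous_lowerReg (Y : Set X) (l : X → ℝ≥0∞) :
    LowerSemicontinuous (lowerReg Y l) := by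
  intro x c hc
  simp only [lowerReg, lt_iSup_iff] at hc
  obtain ⟨G, hG, hx, hlt⟩ := hc
  filter_upwards [hG.mem_nhds hx] with y hy
  exact hlt.trans_le (le_lowerReg hG hy)

lemma lowerReg_eq_top {x : X} (hx : x ∉ closure Y) : lowerReg Y l x = ⊤ := by
  refine top_le_iff.1 (le_trans (le_of_eq ?_) (le_lowerReg isClosed_closure.isOpen_compl hx))
  have h : (closure Y)ᶜ ∩ Y = ∅ := by
    ext y
    simpa using fun h h' => h (subset_closure h')
  simp [h]

lemma lowerReg_congr {l' : X → ℝ≥0∞} (h : ∀ y ∈ Y, l y = l' y) :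
    lowerReg Y l = lowerReg Y l' := by
  ext x
  exact iSup_congr fun G => iSup_congr fun _ => iSup_congr fun _ =>
    iInf_congr fun y => iInf_congr fun hy => h y hy.2

variable [MeasurableSpace X] {ι : Type*} [Preorder ι] {μ : ι → Measure X} {t : ι → ℝ}

/-- An infimum over open neighbourhoods is upper semicontinuous, so its `negLog` is not lowered by
regularization, whatever `Y` is. -/
lemma negLog_upperCap_le_lowerReg (Y : Set X) (x : X) (h1 : upperCap μ t x ≤ 1) :
    negLog (upperCap μ t x) ≤ lowerReg Y (fun y => negLog (upperCap μ t y)) x := by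
  rw [← exp_neg_coe_le_iff_negLog_le h1]
  refine le_iInf fun G => le_iInf fun hG => le_iInf fun hx => ?_
  by_cases hle : limsup (powMeas μ t G) atTop ≤ 1
  · rw [exp_neg_coe_le_iff_negLog_le hle]
    have h : ∀ y ∈ G ∩ Y, negLog (limsup (powMeas μ t G) atTop) ≤ negLog (upperCap μ t y) :=
      fun y hy => negLog_antitone (upperCap_le hG hy.1)
    exact (le_iInf₂ h).trans (le_lowerReg (l := fun y => negLog (upperCap μ t y)) hG hx)
  -- The measures are arbitrary here, so the limsup may exceed 1; the left side never does.
  · refine le_trans ?_ (not_le.1 hle).le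
    simp [EReal.exp_le_one_iff, EReal.neg_le, EReal.coe_ennreal_nonneg]

/-- Regularizing only lowers the function on `Y`, which helps the upper bound. The lower bound
survives because `G` is itself a neighbourhood competing in the supremum. -/
lemma isLDP_lowerReg [(atTop : Filter ι).NeBot] [∀ α, IsProbabilityMeasure (μ α)]
    (ht : ∀ α, 0 < t α) (hcap : ∀ x, lowerCap μ t x = upperCap μ t x)
    (hY : ∀ F, IsClosed F → limsup (powMeas μ t F) atTop ≤ ⨆ x ∈ F ∩ Y, upperCap μ t x) :
    IsLDP μ t (lowerReg Y fun y => negLog (upperCap μ t y)) where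
  lsc := lowerSemicontinuous_lowerReg _ _
  upper F hF := (hY F hF).trans <| iSup₂_le fun x hx => by
    refine le_iSup₂_of_le x hx.1 ?_
    conv_lhs => rw [← exp_neg_coe_negLog (upperCap_le_one ht x)]
    exact exp_neg_coe_le_iff.2 (lowerReg_le hx.2)
  lower G hG := iSup₂_le fun x hx => by
    have hle : liminf (powMeas μ t G) atTop ≤ 1 :=
      le_trans liminf_le_limsup (limsup_le_of_le (by isBoundedDefault)
        (Eventually.of_forall (powMeas_le_one ht G)))
    rw [exp_neg_coe_le_iff_negLog_le hle]
    have h : ∀ y ∈ G ∩ Y, negLog (liminf (powMeas μ t G) atTop) ≤ negLog (upperCap μ t y) :=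
      fun y hy => negLog_antitone (hcap y ▸ lowerCap_le hG hy.1)
    exact (le_iInf₂ h).trans (le_lowerReg (l := fun y => negLog (upperCap μ t y)) hG hx)

/-- Where `J x > c`, regularity gives a closed neighbourhood on which `J > c`; the upper bound there
and the lower bound on its interior force `J' x ≥ c`. -/
lemma IsLDP.le_of_regularSpace [RegularSpace X] [(atTop : Filter ι).NeBot] (ht : ∀ α, 0 < t α)
    {J J' : X → ℝ≥0∞} (hJ : IsLDP μ t J) (hJ' : IsLDP μ t J') : J ≤ J' := by
  intro x
  refine le_of_forall_lt_imp_le_of_dense fun c hc => ?_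
  obtain ⟨W, ⟨hxW, hW⟩, hWc⟩ := ((closed_nhds_basis x).mem_iff.1 (hJ.lsc x c hc))
  rw [← exp_neg_coe_le_iff]
  calc EReal.exp (-(J' x : EReal))
      ≤ ⨆ y ∈ interior W, EReal.exp (-(J' y : EReal)) :=
        le_iSup₂ (f := fun y _ => EReal.exp (-(J' y : EReal))) x (mem_interior_iff_mem_nhds.2 hxW)
    _ ≤ liminf (powMeas μ t (interior W)) atTop := hJ'.lower _ isOpen_interior
    _ ≤ limsup (powMeas μ t (interior W)) atTop := liminf_le_limsup
    _ ≤ limsup (powMeas μ t W) atTop := limsup_powMeas_mono ht interior_subset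
    _ ≤ ⨆ y ∈ W, EReal.exp (-(J y : EReal)) := hJ.upper _ hW
    _ ≤ EReal.exp (-(c : EReal)) := iSup₂_le fun y hy => exp_neg_coe_le_iff.2 (hWc hy).le

end RateFunction

/-! ### Transforms of Λ and truncations -/

section Transforms

variable {X : Type*} [TopologicalSpace X] [MeasurableSpace X]
  {ι : Type*} [Preorder ι] {μ : ι → Measure X} {t : ι → ℝ}

omit [TopologicalSpace X] [Preorder ι] in
lemma powInt_mono (ht : ∀ α, 0 < t α) {f g : X → EReal} (h : f ≤ g) (α : ι) :
    powInt μ t f α ≤ powInt μ t g α :=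
  ENNReal.rpow_le_rpow (lintegral_mono fun x => EReal.exp_monotone
    (EReal.div_le_div_right_of_nonneg (by exact_mod_cast (ht α).le) (h x))) (ht α).le

omit [TopologicalSpace X] in
lemma lowerLambda_mono (ht : ∀ α, 0 < t α) {f g : X → EReal} (h : f ≤ g) :
    lowerLambda μ t f ≤ lowerLambda μ t g :=
  ENNReal.log_monotone (liminf_le_liminf (Eventually.of_forall (powInt_mono ht h)))

omit [MeasurableSpace X] in
lemma trunc_mono (h : C(X, ℝ)) : Monotone (trunc h) := by
  intro M N hMN x
  unfold trunc
  split_ifs with h1 h2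
  · exact le_rfl
  · exact absurd (h1.trans_le hMN) h2
  · exact bot_le
  · exact le_rfl

omit [MeasurableSpace X] in
lemma trunc_le (h : C(X, ℝ)) (M : ℝ) : trunc h M ≤ toE h := by
  intro x
  unfold trunc
  split_ifs
  · exact le_rfl
  · exact bot_le

lemma tendsto_lowerLambda_trunc (ht : ∀ α, 0 < t α) (h : C(X, ℝ)) :
    Tendsto (fun M : ℝ => lowerLambda μ t (trunc h M)) atTop
      (𝓝 (⨆ M : ℝ, lowerLambda μ t (trunc h M))) :=
  tendsto_atTop_iSup fun _ _ hMN => lowerLambda_mono ht (trunc_mono h hMN)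

lemma limUnder_lowerLambda_trunc (ht : ∀ α, 0 < t α) (h : C(X, ℝ)) :
    limUnder atTop (fun M : ℝ => lowerLambda μ t (trunc h M)) =
      ⨆ M : ℝ, lowerLambda μ t (trunc h M) :=
  (tendsto_lowerLambda_trunc ht h).limUnder_eq

omit [TopologicalSpace X] in
lemma LambdaExists.lambda_eq_upperLambda [(atTop : Filter ι).NeBot] {h : X → EReal}
    (hh : LambdaExists μ t h) : Lambda μ t h = upperLambda μ t h := by
  obtain ⟨a, ha⟩ := hh
  rw [Lambda, upperLambda, ha.limUnder_eq, ha.limsup_eq]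

omit [TopologicalSpace X] in
lemma LambdaExists.lambda_eq_lowerLambda [(atTop : Filter ι).NeBot] {h : X → EReal}
    (hh : LambdaExists μ t h) : Lambda μ t h = lowerLambda μ t h := by
  obtain ⟨a, ha⟩ := hh
  rw [Lambda, lowerLambda, ha.limUnder_eq, ha.liminf_eq]

/-- The transform dominates `-log` of the lower capacity. -/
lemma neg_log_lowerCap_le_iSup {B : Set C(X, ℝ)} {x : X}
    (hB : ∀ b, lowerCap μ t x < b → ∃ h ∈ B,
      liminf (powInt μ t (toE h)) atTop ≤ EReal.exp (h x : EReal) * b) :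
    -ENNReal.log (lowerCap μ t x) ≤ ⨆ h ∈ B, (toE h x - lowerLambda μ t (toE h)) := by
  refine le_of_forall_lt_imp_le_of_dense fun c hc => ?_
  have hlt : lowerCap μ t x < EReal.exp (-c) := by
    rw [← ENNReal.log_lt_log_iff, EReal.log_exp]
    exact EReal.lt_neg_comm.1 hc
  obtain ⟨h, hh, hle⟩ := hB _ hlt
  have h1 := neg_log_le_sub_log hle
  rw [EReal.log_exp, neg_neg] at h1
  exact le_iSup₂_of_le h hh h1

/-- Truncating at `h x + 1` leaves `h` unchanged near `x`, so this single level suffices. -/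
lemma sub_iSup_lowerLambda_trunc_le [BorelSpace X] [(atTop : Filter ι).NeBot]
    (ht : ∀ α, 0 < t α) (h : C(X, ℝ)) (x : X) :
    toE h x - ⨆ M : ℝ, lowerLambda μ t (trunc h M) ≤ -ENNReal.log (lowerCap μ t x) := by
  refine (EReal.sub_le_sub le_rfl
    (le_iSup (fun M : ℝ => lowerLambda μ t (trunc h M)) (h x + 1))).trans ?_
  exact sub_log_le_neg_log
    (exp_mul_lowerCap_le ht (eventually_coe_le_trunc h x (lt_add_one _)))

end Transforms

end LargeDev

/-! ### Assembly -/

theorem mainTheorem1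
    {X : Type*} [TopologicalSpace X] [MeasurableSpace X] [BorelSpace X]
    {ι : Type*} [Preorder ι] [IsDirectedOrder ι] [Nonempty ι]
    (μ : ι → Measure X) [∀ α, IsProbabilityMeasure (μ α)]
    (t : ι → ℝ) (ht : ∀ α, 0 < t α) (ht0 : Tendsto t atTop (𝓝 0))
    (htight : ExpTight μ t)
    (hcond : ExpTightIn μ t (regPart X) ∨ (∀ x ∉ regPart X, lZero μ t x = ⊤) ∨
      CoverCondition μ t)
    (A : Set C(X, ℝ)) (hA : IsSeparatingAlgebra A ∨ IsWellSeparating A)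
    (hΛ : (∀ h ∈ baPart A, LambdaExists μ t (toE h)) ∨
      (NonvanishingClass A ∧ ∀ h ∈ nonposPart A, LambdaExists μ t (toE h))) :
    (∀ h ∈ baPart A, LambdaExists μ t (toE h)) ∧
    (∀ h ∈ A, ∃ L : EReal, Tendsto (fun M : ℝ => lowerLambda μ t (trunc h M)) atTop (𝓝 L)) ∧
    ∃ J : X → ℝ≥0∞, IsLDP μ t J ∧
      (∀ x ∉ closure (regPart X), J x = ⊤) ∧
      (∀ x ∈ regPart X,
        ((J x : ℝ≥0∞) : EReal) = (⨆ h ∈ baPart A, (toE h x - Lambda μ t (toE h))) ∧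
        ((J x : ℝ≥0∞) : EReal) = (⨆ h ∈ A, (toE h x - upperLambda μ t (toE h))) ∧
        ((J x : ℝ≥0∞) : EReal) = (⨆ h ∈ A, (toE h x - lowerLambda μ t (toE h))) ∧
        ((J x : ℝ≥0∞) : EReal) =
          (⨆ h ∈ A, (toE h x - limUnder atTop (fun M : ℝ => lowerLambda μ t (trunc h M))))) ∧
      (NonvanishingClass A → ∀ x ∈ regPart X,
        ((J x : ℝ≥0∞) : EReal) = (⨆ h ∈ nonposPart A, (toE h x - Lambda μ t (toE h)))) ∧
      (RegularSpace X →
        (∀ x, J x = ⨆ (G : Set X) (_ : IsOpen G) (_ : x ∈ G), ⨅ y ∈ G ∩ regPart X, J y) ∧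
        ∀ J' : X → ℝ≥0∞, IsLDP μ t J' → J' = J) := by
  -- Makes compact sets closed, hence Borel.
  have : T2Space X := t2Space_of_separates (separatesPts_of hA)
  have hcap := lowerCap_eq_upperCap ht ht0 htight hA hΛ
  have hex : ∀ h : C(X, ℝ), BddAbove (range h) → LambdaExists μ t (toE h) :=
    lambdaExists_of_bddAbove ht ht0 htight hcap
  have hJ : ∀ x ∈ regPart X, lowerReg (regPart X) (fun y => negLog (upperCap μ t y)) x =
      negLog (upperCap μ t x) := fun x hx =>
    le_antisymm (lowerReg_le hx) (negLog_upperCap_le_lowerReg _ x (upperCap_le_one ht x))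
  have hLDP := isLDP_lowerReg ht hcap
    (fun F hF => limsup_powMeas_le_regPart ht ht0 htight hcond hF)
  have hnonpos : nonposPart A ⊆ baPart A := fun h hh =>
    ⟨hh.1, 0, forall_mem_range.2 hh.2⟩
  refine ⟨fun h hh => hex h hh.2, fun h _ => ⟨_, tendsto_lowerLambda_trunc ht h⟩, _, hLDP,
    fun x hx => lowerReg_eq_top hx, fun x hx => ?_, fun hn x hx => ?_, fun hreg => ⟨?_, ?_⟩⟩
  -- On X₀ the rate function becomes -log `lowerCap`; `try` skips the two goals about regular
  -- spaces.
  all_goals try rw [hJ x hx, coe_negLog (upperCap_le_one ht x), ← hcap x]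
  -- The inequalities `h1` to `h5` form a cycle through the four transforms, so all of them are
  -- equalities.
  · have h1 : -ENNReal.log (lowerCap μ t x) ≤
        ⨆ h ∈ baPart A, (toE h x - Lambda μ t (toE h)) := by
      refine (neg_log_lowerCap_le_iSup (B := baPart A) fun b hb => ?_).trans
        (iSup₂_mono fun h hh => by rw [(hex h hh.2).lambda_eq_lowerLambda])
      obtain ⟨h, hh, hb, -, hle⟩ := exists_liminf_powInt_le ht ht0 htight hA hb
      exact ⟨h, ⟨hh, hb⟩, hle⟩
    have h2 : (⨆ h ∈ baPart A, (toE h x - Lambda μ t (toE h))) ≤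
        ⨆ h ∈ A, (toE h x - upperLambda μ t (toE h)) :=
      iSup₂_le fun h hh => by
        rw [(hex h hh.2).lambda_eq_upperLambda]
        exact le_iSup₂_of_le h hh.1 le_rfl
    have h3 : (⨆ h ∈ A, (toE h x - upperLambda μ t (toE h))) ≤
        ⨆ h ∈ A, (toE h x - lowerLambda μ t (toE h)) :=
      iSup₂_mono fun h _ => EReal.sub_le_sub le_rfl (ENNReal.log_monotone liminf_le_limsup)
    have h4 : (⨆ h ∈ A, (toE h x - lowerLambda μ t (toE h))) ≤
        ⨆ h ∈ A, (toE h x - limUnder atTop (fun M : ℝ => lowerLambda μ t (trunc h M))) :=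
      iSup₂_mono fun h _ => EReal.sub_le_sub le_rfl (by
        rw [limUnder_lowerLambda_trunc ht h]
        exact iSup_le fun M => lowerLambda_mono ht (trunc_le h M))
    have h5 : (⨆ h ∈ A, (toE h x - limUnder atTop (fun M : ℝ => lowerLambda μ t (trunc h M)))) ≤
        -ENNReal.log (lowerCap μ t x) :=
      iSup₂_le fun h _ => by
        rw [limUnder_lowerLambda_trunc ht h]
        exact sub_iSup_lowerLambda_trunc_le ht h x
    exact ⟨h1.antisymm (h2.trans (h3.trans (h4.trans h5))),
      (h1.trans h2).antisymm (h3.trans (h4.trans h5)),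
      (h1.trans (h2.trans h3)).antisymm (h4.trans h5),
      (h1.trans (h2.trans (h3.trans h4))).antisymm h5⟩
  · refine le_antisymm ?_ (iSup₂_le fun h hh => ?_)
    · refine (neg_log_lowerCap_le_iSup (B := nonposPart A) fun b hb => ?_).trans
        (iSup₂_mono fun h hh => by rw [(hex h (hnonpos hh).2).lambda_eq_lowerLambda])
      obtain ⟨h, hh, -, hnv, hle⟩ := exists_liminf_powInt_le ht ht0 htight hA hb
      exact ⟨h, ⟨hh, hnv hn⟩, hle⟩
    · rw [(hex h (hnonpos hh).2).lambda_eq_lowerLambda]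
      exact sub_log_le_neg_log (exp_mul_lowerCap_le ht (eventually_coe_le_toE h x))
  · exact fun x => congrFun (lowerReg_congr fun y hy => (hJ y hy).symm) x
  · exact fun J' hJ' => (hJ'.le_of_regularSpace ht hLDP).antisymm (hLDP.le_of_regularSpace ht hJ')
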